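/- There exists $n_0$ such that the following holds for all integers $n \ge n_0$ and $0 \le t \le n/1000$ with $3 \mid n+t$. For a graph $G$, let $e(G)$ denote its number of edges and let $G \ast K_t$ denote the graph obtained from $G$ by adding $t$ new vertices and every edge incident to at least one of them. A $K_3$-factor of a graph is a collection of vertex-disjoint triangles covering every vertex. Put $k = \lceil (t+1)/2 \rceil$. If $G$ is an $n$-vertex graph such that $G \ast K_t$ does not have a $K_3$-factor, then $$ e(G)\leq \binom{n}{2} - \binom{k}{2} - \begin{cases} k(n-k), &\text{if } t \text{ is odd,} \\ k(n-k-1), &\text{if } t \text{ is even.} \end{cases} $$ This bound is sharp: for all such $n$ and $t$ there is an $n$-vertex graph $G$ for which $G \ast K_t$ has no $K_3$-factor and equality holds. -/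

import Mathlib

namespace TriangleFactorDeficiency

/-- The join of two graphs on disjoint vertex sets: the disjoint union of `G` and `H` together with
every edge between a vertex of `G` and a vertex of `H`. -/
def join {V W : Type*} (G : SimpleGraph V) (H : SimpleGraph W) : SimpleGraph (V ⊕ W) :=
  (G ⊕g H) ⊔ completeBipartiteGraph V W

/-- `joinComplete G t` is the graph `G ∗ K_t`: the join of `G` with the complete graph on `t` new
vertices. -/
def joinComplete {V : Type*} (G : SimpleGraph V) (t : ℕ) : SimpleGraph (V ⊕ Fin t) :=
  join G (⊤ : SimpleGraph (Fin t))

/-- `G` has a `K_r`-factor: a collection of pairwise vertex-disjoint copies of `K_r` in `G`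
(given by their vertex sets, the `r`-cliques of `G`) covering every vertex of `G`. -/
def HasCliqueFactor {V : Type*} (G : SimpleGraph V) (r : ℕ) : Prop :=
  ∃ P : Set (Finset V), (∀ s ∈ P, G.IsNClique r s) ∧ P.PairwiseDisjoint id ∧ ∀ v, ∃ s ∈ P, v ∈ s

/-- The integer `k = ⌈(t + 1) / 2⌉`. -/
def halfCeil (t : ℕ) : ℕ := ⌈((t : ℚ) + 1) / 2⌉₊

/-- The extremal number of edges: `C(n,2) - C(k,2) - k(n-k)` if `t` is odd, and
`C(n,2) - C(k,2) - k(n-k-1)` if `t` is even, where `k = ⌈(t+1)/2⌉`. The subtractions are those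
of the integers. -/
def edgeBound (n t : ℕ) : ℤ :=
  (n.choose 2 : ℤ) - ((halfCeil t).choose 2 : ℤ) -
    if Odd t then (halfCeil t : ℤ) * ((n : ℤ) - (halfCeil t : ℤ))
    else (halfCeil t : ℤ) * ((n : ℤ) - (halfCeil t : ℤ) - 1)

end TriangleFactorDeficiency

namespace TriangleFactorDeficiency

open Finset

/-! Write k = ⌊t/2⌋ + 1 and m = n - k. The bound equals C(m,2), plus k when t is even. Suppose G has
more edges. All but O(k) vertices then have at most n/16 non-neighbours
(`card_filter_low_degree_le`). The factor is built from the worst vertices up. The set T of vertices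
of degree below n/7 is the real obstruction: a vertex of T can always be covered using two new
vertices, which suffices if 2|T| ≤ t. Otherwise new vertices must be saved, for instance by
completing an edge of G at T with a single one. The edges beyond those avoiding T supply enough
disjoint savings (`exists_cover_of_degree_le`). The remaining bad vertices are covered greedily by
triangles of G, and what is left is so dense that Hall's theorem tiles it
(`IsTriangleTiled.of_card_not_adj_le`).

For sharpness, k independent vertices with at most one common neighbour need more partners than are
available (`not_hasCliqueFactor_extremalGraph`). -/

/-- The vertices in `S` can be partitioned into triangles of `Γ`. -/
def IsTriangleTiled {W : Type*} (Γ : SimpleGraph W) (S : Finset W) : Prop :=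
  ∃ P : Set (Finset W), (∀ s ∈ P, Γ.IsNClique 3 s) ∧ P.PairwiseDisjoint id ∧
    ∀ v, v ∈ S ↔ ∃ s ∈ P, v ∈ s

/-! ### Combining and extending triangle tilings -/

section Tiled

variable {W : Type*} {Γ : SimpleGraph W}

theorem IsTriangleTiled.empty : IsTriangleTiled Γ ∅ :=
  ⟨∅, by simp, by simp, by simp⟩

theorem IsTriangleTiled.hasCliqueFactor [Fintype W] (h : IsTriangleTiled Γ univ) :
    HasCliqueFactor Γ 3 := by
  obtain ⟨P, h1, h2, h3⟩ := h
  exact ⟨P, h1, h2, fun v => (h3 v).1 (mem_univ v)⟩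

variable [DecidableEq W]

theorem IsTriangleTiled.union {S T : Finset W} (hS : IsTriangleTiled Γ S)
    (hT : IsTriangleTiled Γ T) (hST : Disjoint S T) : IsTriangleTiled Γ (S ∪ T) := by
  obtain ⟨P, hP1, hP2, hP3⟩ := hS
  obtain ⟨Q, hQ1, hQ2, hQ3⟩ := hT
  refine ⟨P ∪ Q, ?_, ?_, ?_⟩
  · rintro s (hs | hs)
    exacts [hP1 s hs, hQ1 s hs]
  · rw [Set.pairwiseDisjoint_union]
    refine ⟨hP2, hQ2, fun i hi j hj _ => ?_⟩
    rw [Finset.disjoint_left]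
    intro v hvi hvj
    exact Finset.disjoint_left.1 hST ((hP3 v).2 ⟨i, hi, hvi⟩) ((hQ3 v).2 ⟨j, hj, hvj⟩)
  · intro v
    rw [mem_union, hP3, hQ3]
    constructor
    · rintro (⟨s, hs, hv⟩ | ⟨s, hs, hv⟩)
      exacts [⟨s, Or.inl hs, hv⟩, ⟨s, Or.inr hs, hv⟩]
    · rintro ⟨s, hs | hs, hv⟩
      exacts [Or.inl ⟨s, hs, hv⟩, Or.inr ⟨s, hs, hv⟩]

theorem IsTriangleTiled.triangle {a b c : W} (hab : Γ.Adj a b) (hac : Γ.Adj a c)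
    (hbc : Γ.Adj b c) : IsTriangleTiled Γ {a, b, c} := by
  refine ⟨{{a, b, c}}, ?_, by simp, by simp⟩
  rintro s rfl
  exact SimpleGraph.is3Clique_triple_iff.2 ⟨hab, hac, hbc⟩

theorem IsTriangleTiled.insert_triangle {S : Finset W} (hS : IsTriangleTiled Γ S) {a b c : W}
    (hab : Γ.Adj a b) (hac : Γ.Adj a c) (hbc : Γ.Adj b c) (ha : a ∉ S) (hb : b ∉ S)
    (hc : c ∉ S) : IsTriangleTiled Γ (insert a (insert b (insert c S))) := by
  have := (IsTriangleTiled.triangle hab hac hbc).union hS (by simp [ha, hb, hc])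
  simpa using this

/-- If every vertex of `X` outside `U` lies in a triangle avoiding any given small set, then a
tiling of `U` extends greedily to one covering `X`. -/
theorem IsTriangleTiled.exists_cover {U : Finset W} (hU : IsTriangleTiled Γ U) (X : Finset W)
    {M : ℕ} (hM : U.card + 3 * X.card ≤ M)
    (h : ∀ v ∈ X, v ∉ U → ∀ F : Finset W, F.card ≤ M →
      ∃ a ∉ F, ∃ b ∉ F, Γ.Adj v a ∧ Γ.Adj v b ∧ Γ.Adj a b) :
    ∃ U', IsTriangleTiled Γ U' ∧ U ⊆ U' ∧ X ⊆ U' ∧ U'.card ≤ U.card + 3 * X.card := by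
  induction X using Finset.induction_on with
  | empty => exact ⟨U, hU, Subset.rfl, by simp, by simp⟩
  | insert v X hv ih =>
    rw [card_insert_of_notMem hv] at hM ⊢
    obtain ⟨U', hU', hUU', hX, hc⟩ := ih (by omega) fun w hw => h w (mem_insert_of_mem hw)
    by_cases hvU : v ∈ U'
    · exact ⟨U', hU', hUU', by simp [insert_subset_iff, hvU, hX], by omega⟩
    · obtain ⟨a, ha, b, hb, hva, hvb, hab⟩ := h v (mem_insert_self v X)
        (fun hv' => hvU (hUU' hv')) U' (by omega)
      refine ⟨_, hU'.insert_triangle hva hvb hab hvU ha hb, ?_, ?_, ?_⟩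
      · exact hUU'.trans fun x hx => by simp [hx]
      · exact insert_subset_iff.2 ⟨by simp, hX.trans fun x hx => by simp [hx]⟩
      · have h1 := card_insert_le v (insert a (insert b U'))
        have h2 := card_insert_le a (insert b U')
        have h3 := card_insert_le b U'
        omega

end Tiled

/-! ### Tiling dense sets by Hall's theorem -/

open Classical in
-- Hall's condition holds: a nonempty set of at most d rows already sees m - d ≥ d columns through
-- one row, and a set of more than d rows sees every column.
theorem exists_perm_of_card_not_le {m d : ℕ} (R : Fin m → Fin m → Prop)
    (h₁ : ∀ i, #{j | ¬ R i j} ≤ d) (h₂ : ∀ j, #{i | ¬ R i j} ≤ d) (hd : 2 * d ≤ m) :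
    ∃ σ : Equiv.Perm (Fin m), ∀ i, R i (σ i) := by
  obtain ⟨f, hf, hfR⟩ := (Finset.all_card_le_biUnion_card_iff_exists_injective
    (fun i : Fin m => ({j | R i j} : Finset (Fin m)))).1 (by
      intro S
      by_cases hS : S.card ≤ d
      · rcases S.eq_empty_or_nonempty with rfl | ⟨i, hi⟩
        · simp
        · have h3 := card_le_card (subset_biUnion_of_mem
            (fun i : Fin m => ({j | R i j} : Finset (Fin m))) hi)
          have h4 : #{j | R i j} + #{j | ¬ R i j} = m := by
            rw [card_filter_add_card_filter_not, card_univ, Fintype.card_fin]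
          have h5 := h₁ i
          omega
      · have : S.biUnion (fun i : Fin m => ({j | R i j} : Finset (Fin m))) = univ := by
          ext j
          simp only [mem_biUnion, mem_filter, mem_univ, true_and, iff_true]
          by_contra! hj
          exact hS ((card_le_card fun i hi => by simpa using hj i hi).trans (h₂ j))
        rw [this]
        exact card_le_univ S)
  refine ⟨Equiv.ofBijective f (Finite.injective_iff_bijective.1 hf), fun i => ?_⟩
  simpa using hfR i

open Classical in
/-- A set in which every vertex has few non-neighbours is tiled by triangles. -/
theorem IsTriangleTiled.of_card_not_adj_le {W : Type*} {Γ : SimpleGraph W} {S : Finset W}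
    {m d : ℕ} (hS : S.card = 3 * m) (h : ∀ v ∈ S, #{w ∈ S | ¬ Γ.Adj v w} ≤ d)
    (hd : 4 * d ≤ m) : IsTriangleTiled Γ S := by
  have e : Fin 3 × Fin m ≃ S := Fintype.equivOfCardEq (by simp [hS])
  -- An arbitrary split of `S` into three classes of size m.
  let f : Fin 3 → Fin m → W := fun q j => e (q, j)
  have hfS : ∀ q j, f q j ∈ S := fun q j => (e (q, j)).2
  have hfi : ∀ q j q' j', f q j = f q' j' → q = q' ∧ j = j' := by
    intro q j q' j' hh
    have := e.injective (Subtype.ext hh)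
    simpa using this
  have hcount : ∀ v ∈ S, ∀ q, ∀ σ : Equiv.Perm (Fin m), #{j | ¬ Γ.Adj v (f q (σ j))} ≤ d := by
    intro v hv q σ
    refine le_trans (card_le_card_of_injOn (fun j => f q (σ j)) ?_ ?_) (h v hv)
    · intro j hj
      simpa [hfS] using hj
    · intro j _ j' _ hjj
      exact σ.injective (hfi _ _ _ _ hjj).2
  have hcount' : ∀ v ∈ S, ∀ q, ∀ σ : Equiv.Perm (Fin m), #{j | ¬ Γ.Adj (f q (σ j)) v} ≤ d := by
    intro v hv q σ
    simpa only [Γ.adj_comm _ v] using hcount v hv q σ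
  obtain ⟨σ, hσ⟩ := exists_perm_of_card_not_le (d := d) (fun i j => Γ.Adj (f 0 i) (f 1 j))
    (fun i => hcount _ (hfS 0 i) 1 1)
    (fun j => hcount' _ (hfS 1 j) 0 1) (by omega)
  -- Match the edges just found to the third class. An edge is blocked by non-neighbours of either
  -- end, hence d + d.
  obtain ⟨τ, hτ⟩ := exists_perm_of_card_not_le (d := d + d)
    (fun i j => Γ.Adj (f 0 i) (f 2 j) ∧ Γ.Adj (f 1 (σ i)) (f 2 j))
    (fun i => by
      simp only [not_and_or, filter_or]
      exact (card_union_le _ _).trans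
        (add_le_add (hcount _ (hfS 0 i) 2 1) (hcount _ (hfS 1 _) 2 1)))
    (fun j => by
      simp only [not_and_or, filter_or]
      refine (card_union_le _ _).trans (add_le_add ?_ ?_)
      · exact hcount' _ (hfS 2 j) 0 1
      · exact hcount' _ (hfS 2 j) 1 σ) (by omega)
  refine ⟨Set.range fun i => {f 0 i, f 1 (σ i), f 2 (τ i)}, ?_, ?_, ?_⟩
  · rintro _ ⟨i, rfl⟩
    exact SimpleGraph.is3Clique_triple_iff.2 ⟨hσ i, (hτ i).1, (hτ i).2⟩
  · rintro _ ⟨i, rfl⟩ _ ⟨i', rfl⟩ hne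
    have hii : i ≠ i' := fun hh => hne (by rw [hh])
    change Disjoint ({f 0 i, f 1 (σ i), f 2 (τ i)} : Finset W) {f 0 i', f 1 (σ i'), f 2 (τ i')}
    rw [Finset.disjoint_left]
    intro v hv hv'
    simp only [mem_insert, mem_singleton] at hv hv'
    rcases hv with rfl | rfl | rfl <;> rcases hv' with hv' | hv' | hv' <;>
      have := hfi _ _ _ _ hv' <;> simp_all
  · intro v
    constructor
    · intro hv
      obtain ⟨⟨q, j⟩, hqj⟩ := e.surjective ⟨v, hv⟩
      have hvf : v = f q j := by simp [f, hqj]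
      fin_cases q
      · exact ⟨_, ⟨j, rfl⟩, by simp [hvf]⟩
      · exact ⟨_, ⟨σ.symm j, rfl⟩, by simp [hvf]⟩
      · exact ⟨_, ⟨τ.symm j, rfl⟩, by simp [hvf]⟩
    · rintro ⟨_, ⟨i, rfl⟩, hv⟩
      simp only [mem_insert, mem_singleton] at hv
      rcases hv with rfl | rfl | rfl <;> exact hfS _ _

/-! ### Covering vertices with the help of the new vertices -/

section Join

variable {V : Type*} {G : SimpleGraph V} {t : ℕ}

@[simp]
theorem joinComplete_adj_inl_inl {v w : V} :
    (joinComplete G t).Adj (.inl v) (.inl w) ↔ G.Adj v w := by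
  simp [joinComplete, join]

@[simp]
theorem joinComplete_adj_inl_inr {v : V} {x : Fin t} :
    (joinComplete G t).Adj (.inl v) (.inr x) := by
  simp [joinComplete, join]

@[simp]
theorem joinComplete_adj_inr_inl {v : V} {x : Fin t} :
    (joinComplete G t).Adj (.inr x) (.inl v) := by
  simp [joinComplete, join]

@[simp]
theorem joinComplete_adj_inr_inr {x y : Fin t} :
    (joinComplete G t).Adj (.inr x) (.inr y) ↔ x ≠ y := by
  simp [joinComplete, join]

variable [DecidableEq V]

/-- Each vertex of `T` is put into a triangle with two of the new vertices. -/
theorem IsTriangleTiled.exists_cover_of_card_toRight {U : Finset (V ⊕ Fin t)}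
    (hU : IsTriangleTiled (joinComplete G t) U) (T : Finset V) (hT : ∀ b ∈ T, .inl b ∉ U)
    (hc : #U.toRight + 2 * #T ≤ t) :
    ∃ U', IsTriangleTiled (joinComplete G t) U' ∧ U ⊆ U' ∧ (∀ b ∈ T, .inl b ∈ U') ∧
      #U' ≤ #U + 3 * #T := by
  induction T using Finset.induction_on generalizing U with
  | empty => exact ⟨U, hU, Subset.rfl, by simp, by simp⟩
  | insert b T hb ih =>
    rw [card_insert_of_notMem hb] at hc ⊢
    obtain ⟨x, hx, y, hy, hxy⟩ : ∃ x ∈ U.toRightᶜ, ∃ y ∈ U.toRightᶜ, x ≠ y := by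
      rw [← one_lt_card, card_compl, Fintype.card_fin]
      omega
    simp only [mem_compl, mem_toRight] at hx hy
    have hbU := hT b (mem_insert_self b T)
    have h1 : #(insert (.inl b) (insert (.inr x) (insert (.inr y) U))) = #U + 3 := by
      rw [card_insert_of_notMem (by simpa using hbU), card_insert_of_notMem (by simp [hxy, hx]),
        card_insert_of_notMem hy]
    obtain ⟨U', h2, h3, h4, h5⟩ := ih (hU.insert_triangle (a := .inl b) (b := .inr x)
      (c := .inr y) (by simp) (by simp) (by simpa) hbU hx hy)
      (fun c hc' => by
        have : c ≠ b := fun hh => hb (hh ▸ hc')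
        simp [this, hT c (mem_insert_of_mem hc')])
      (by
        simp only [toRight_insert_inl, toRight_insert_inr]
        have := card_insert_le x (insert y U.toRight)
        have := card_insert_le y U.toRight
        omega)
    refine ⟨U', h2, Subset.trans (fun z hz => by simp [hz]) h3, ?_, by omega⟩
    intro c hc'
    rcases mem_insert.1 hc' with rfl | hc'
    · exact h3 (mem_insert_self _ _)
    · exact h4 c hc'

/-- A tiling which covers many vertices of `T` and few of the new vertices extends to one covering
all of `T`. -/
theorem IsTriangleTiled.exists_cover_of_saving {U : Finset (V ⊕ Fin t)}
    (hU : IsTriangleTiled (joinComplete G t) U) (T : Finset V)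
    (hc : #U.toRight + 2 * #T ≤ t + 2 * #(T ∩ U.toLeft)) (hU3 : #U ≤ 3 * #(T ∩ U.toLeft)) :
    ∃ U', IsTriangleTiled (joinComplete G t) U' ∧ (∀ b ∈ T, .inl b ∈ U') ∧ #U' ≤ 3 * #T := by
  have h := card_sdiff_add_card_inter T U.toLeft
  obtain ⟨U', h1, h2, h3, h4⟩ := hU.exists_cover_of_card_toRight (T \ U.toLeft)
    (fun b hb => by simpa using (mem_sdiff.1 hb).2) (by omega)
  refine ⟨U', h1, fun b hb => ?_, by omega⟩
  by_cases hbU : .inl b ∈ U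
  · exact h2 hbU
  · exact h3 b (by simp [hb, hbU])

end Join

/-! ### Edge counts, by ordered adjacent pairs -/

section Counting

variable {V : Type*} [Fintype V] (G : SimpleGraph V) [DecidableRel G.Adj]

theorem card_filter_adj : #{p : V × V | G.Adj p.1 p.2} = 2 * #G.edgeFinset := by
  rw [← G.sum_degrees_eq_twice_card_edges, card_filter, Fintype.sum_prod_type]
  refine sum_congr rfl fun v _ => ?_
  rw [← card_filter, ← G.card_neighborFinset_eq_degree, G.neighborFinset_eq_filter]

variable {G} [DecidableEq V]

/-- If the graph has more edges than can be accounted for by the edges avoiding `T` and those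
meeting both `T` and `Q`, then some edge meets `T` and avoids `Q`. -/
theorem exists_adj_avoiding {T Q : Finset V} {D : ℕ} (hQT : ∀ q ∈ Q, q ∈ T → G.degree q ≤ D)
    (hTD : ∀ q ∈ Q, q ∉ T → #T ≤ D)
    (h : #Tᶜ * #Tᶜ + 2 * (#Q * D) < 2 * #G.edgeFinset + #Tᶜ) :
    ∃ b ∈ T, ∃ w, G.Adj b w ∧ b ∉ Q ∧ w ∉ Q := by
  by_contra! hcon
  -- `X q` holds the other ends of the edges charged to q: all edges at q if q lies in T, otherwise
  -- only possible edges from q into T.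
  let X : V → Finset V := fun q => if q ∈ T then G.neighborFinset q else T
  have hX : ∀ q ∈ Q, #(X q) ≤ D := by
    intro q hq
    by_cases hqT : q ∈ T
    · simpa [X, hqT] using hQT q hq hqT
    · simpa [X, hqT] using hTD q hq hqT
  have hsub : ({p : V × V | G.Adj p.1 p.2} : Finset (V × V)) ⊆ Tᶜ.offDiag ∪
      (Q.biUnion (fun q => (X q).image (Prod.mk q)) ∪
        Q.biUnion (fun q => (X q).image (fun x => (x, q)))) := by
    rintro ⟨u, v⟩ huv
    replace huv : G.Adj u v := by simpa using huv
    have key : (∃ q ∈ Q, q = u ∧ v ∈ X q) ∨ (∃ q ∈ Q, q = v ∧ u ∈ X q) ∨ (u ∉ T ∧ v ∉ T) := by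
      by_cases huT : u ∈ T
      · by_cases huQ : u ∈ Q
        · exact Or.inl ⟨u, huQ, rfl, by simp [X, huT, huv]⟩
        · have hvQ := hcon u huT v huv huQ
          refine Or.inr (Or.inl ⟨v, hvQ, rfl, ?_⟩)
          by_cases hvT : v ∈ T <;> simp [X, hvT, huT, huv.symm]
      · by_cases hvT : v ∈ T
        · by_cases hvQ : v ∈ Q
          · exact Or.inr (Or.inl ⟨v, hvQ, rfl, by simp [X, hvT, huv.symm]⟩)
          · exact Or.inl ⟨u, hcon v hvT u huv.symm hvQ, rfl, by simp [X, huT, hvT]⟩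
        · exact Or.inr (Or.inr ⟨huT, hvT⟩)
    simp only [mem_union, mem_biUnion, mem_image, mem_offDiag, mem_compl, Prod.mk.injEq]
    rcases key with ⟨q, hq, rfl, hv⟩ | ⟨q, hq, rfl, hu⟩ | ⟨hu, hv⟩
    · exact Or.inr (Or.inl ⟨q, hq, v, hv, rfl, rfl⟩)
    · exact Or.inr (Or.inr ⟨q, hq, u, hu, rfl, rfl⟩)
    · exact Or.inl ⟨hu, hv, huv.ne⟩
  have h1 := card_le_card hsub
  rw [card_filter_adj] at h1
  have h2 := card_union_le Tᶜ.offDiag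
      (Q.biUnion (fun q => (X q).image (Prod.mk q)) ∪
        Q.biUnion (fun q => (X q).image (fun x => (x, q))))
  have h3 := card_union_le (Q.biUnion (fun q => (X q).image (Prod.mk q)))
        (Q.biUnion (fun q => (X q).image (fun x => (x, q))))
  have h4 : #(Q.biUnion (fun q => (X q).image (Prod.mk q))) ≤ #Q * D :=
    card_biUnion_le_card_mul _ _ _ fun q hq => card_image_le.trans (hX q hq)
  have h5 : #(Q.biUnion (fun q => (X q).image (fun x => (x, q)))) ≤ #Q * D :=
    card_biUnion_le_card_mul _ _ _ fun q hq => card_image_le.trans (hX q hq)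
  rw [offDiag_card] at h2
  have h6 : #Tᶜ ≤ #Tᶜ * #Tᶜ := Nat.le_mul_self _
  omega

/-- If every edge meeting `T` contains `b ∈ T` and the neighbourhood of `b` is independent and
disjoint from `T`, then the graph has few edges. -/
theorem card_edgeFinset_le_of_star {T : Finset V} {b : V}
    (hT : ∀ u ∈ T, ∀ v, G.Adj u v → u = b) (hbT : ∀ v, G.Adj b v → v ∉ T)
    (hb : ∀ v w, G.Adj b v → G.Adj b w → ¬ G.Adj v w) :
    2 * #G.edgeFinset + #Tᶜ ≤ #Tᶜ * #Tᶜ + 2 := by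
  set N := G.neighborFinset b with hN
  have hNT : N.offDiag ⊆ Tᶜ.offDiag := by
    refine offDiag_mono fun v hv => ?_
    simpa using hbT v (by simpa [hN] using hv)
  have hsub : ({p : V × V | G.Adj p.1 p.2} : Finset (V × V)) ⊆ (Tᶜ.offDiag \ N.offDiag) ∪
      (N.image (Prod.mk b) ∪ N.image (fun x => (x, b))) := by
    rintro ⟨u, v⟩ huv
    replace huv : G.Adj u v := by simpa using huv
    simp only [mem_union, mem_sdiff, mem_image, mem_offDiag, mem_compl, Prod.mk.injEq, hN,
      SimpleGraph.mem_neighborFinset]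
    by_cases huT : u ∈ T
    · obtain rfl := hT u huT v huv
      exact Or.inr (Or.inl ⟨v, huv, rfl, rfl⟩)
    · by_cases hvT : v ∈ T
      · obtain rfl := hT v hvT u huv.symm
        exact Or.inr (Or.inr ⟨u, huv.symm, rfl, rfl⟩)
      · exact Or.inl ⟨⟨huT, hvT, huv.ne⟩, fun hh => hb u v hh.1 hh.2.1 huv⟩
  have h1 := card_le_card hsub
  rw [card_filter_adj] at h1
  have h2 := card_union_le (Tᶜ.offDiag \ N.offDiag)
    (N.image (Prod.mk b) ∪ N.image (fun x => (x, b)))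
  have h3 := card_union_le (N.image (Prod.mk b)) (N.image (fun x => (x, b)))
  have h4 : #(N.image (Prod.mk b)) ≤ #N := card_image_le
  have h5 : #(N.image (fun x => (x, b))) ≤ #N := card_image_le
  have h6 := card_sdiff_add_card_eq_card hNT
  rw [offDiag_card, offDiag_card] at h6
  have h7 : #Tᶜ ≤ #Tᶜ * #Tᶜ := Nat.le_mul_self _
  have h8 : #N ≤ #N * #N := Nat.le_mul_self _
  -- This is (|N| - 1)(|N| - 2) ≥ 0: independence of N loses at least as many edges as the star
  -- adds, up to one.
  have h9 : 3 * #N ≤ #N * #N + 2 := by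
    rcases Nat.lt_or_ge #N 3 with h | h
    · interval_cases #N <;> omega
    · nlinarith
  omega

end Counting

/-! ### Covering the vertices of low degree -/

section LowDegree

variable {V : Type*} [Fintype V] [DecidableEq V] {G : SimpleGraph V} [DecidableRel G.Adj] {t : ℕ}

/-- Greedily choosing disjoint edges meeting `T`, each completed to a triangle by a new vertex. -/
theorem exists_tiling_of_edges {T : Finset V} {D r : ℕ} (hdeg : ∀ v ∈ T, G.degree v ≤ D)
    (hTD : #T ≤ D) (h : #Tᶜ * #Tᶜ + 4 * ((r - 1) * D) < 2 * #G.edgeFinset + #Tᶜ) (hrt : r ≤ t)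
    (i : ℕ) (hi : i ≤ r) :
    ∃ U, IsTriangleTiled (joinComplete G t) U ∧ #U.toLeft = 2 * i ∧ #U.toRight = i ∧
      i ≤ #(T ∩ U.toLeft) := by
  induction i with
  | zero => exact ⟨∅, .empty, by rfl, by rfl, by simp⟩
  | succ i ih =>
    obtain ⟨U, hU, hl, hr, hT⟩ := ih (by omega)
    -- The 2i vertices already used block at most 2iD edges, and i ≤ r - 1.
    obtain ⟨b, hb, w, hbw, hbU, hwU⟩ := exists_adj_avoiding (Q := U.toLeft) (T := T) (D := D)
      (fun q _ hq => hdeg q hq) (fun _ _ _ => hTD) (by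
        rw [hl]
        have : i * D ≤ (r - 1) * D := Nat.mul_le_mul_right _ (by omega)
        nlinarith)
    obtain ⟨x, hx⟩ : ∃ x, x ∈ U.toRightᶜ := by
      rw [← Finset.Nonempty, ← card_pos, card_compl, Fintype.card_fin]
      omega
    simp only [mem_compl] at hx
    refine ⟨_, hU.insert_triangle (a := .inl b) (b := .inl w) (c := .inr x) (by simpa)
      (by simp) (by simp) (by simpa using hbU) (by simpa using hwU) (by simpa using hx),
      ?_, ?_, ?_⟩
    · simp only [toLeft_insert_inl, toLeft_insert_inr]
      rw [card_insert_of_notMem (by simp only [mem_insert, not_or]; exact ⟨hbw.ne, hbU⟩),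
        card_insert_of_notMem hwU]
      omega
    · simp only [toRight_insert_inl, toRight_insert_inr]
      rw [card_insert_of_notMem hx, hr]
    · have hsub : insert b (T ∩ U.toLeft) ⊆ T ∩ (insert b (insert w U.toLeft)) := by
        intro z hz
        simp only [mem_insert, mem_inter] at hz ⊢
        rcases hz with rfl | hz
        · exact ⟨hb, Or.inl rfl⟩
        · exact ⟨hz.1, Or.inr (Or.inr hz.2)⟩
      have := card_le_card hsub
      rw [card_insert_of_notMem (fun hh => hbU (mem_inter.1 hh).2)] at this
      simp only [toLeft_insert_inl, toLeft_insert_inr]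
      omega

/-- Each of the r disjoint edges saves at least one new vertex, so 2|T| - r of them suffice. -/
theorem exists_cover_of_edges {T : Finset V} {D r : ℕ} (hdeg : ∀ v ∈ T, G.degree v ≤ D)
    (hTD : #T ≤ D) (h : #Tᶜ * #Tᶜ + 4 * ((r - 1) * D) < 2 * #G.edgeFinset + #Tᶜ) (hrt : r ≤ t)
    (hr : 2 * #T ≤ t + r) :
    ∃ U, IsTriangleTiled (joinComplete G t) U ∧ (∀ b ∈ T, .inl b ∈ U) ∧ #U ≤ 3 * #T := by
  obtain ⟨U, hU, h1, h2, h3⟩ := exists_tiling_of_edges hdeg hTD h hrt r le_rfl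
  have h4 := card_toLeft_add_card_toRight (u := U)
  exact hU.exists_cover_of_saving T (by omega) (by omega)

/-- The tight case for even `t`. -/
theorem exists_cover_of_card_eq {T : Finset V} (hT : 2 * #T = t + 2)
    (h : #Tᶜ * #Tᶜ + 2 * #T < 2 * #G.edgeFinset + #Tᶜ) :
    ∃ U, IsTriangleTiled (joinComplete G t) U ∧ (∀ b ∈ T, .inl b ∈ U) ∧ #U ≤ 3 * #T := by
  -- Two new vertices must be saved. This is done by an edge inside T, by a triangle of G at T, or
  -- by two disjoint edges meeting T.
  have htwo : ∀ {b b'}, b ∈ T → b' ∈ T → b ≠ b' → 2 ≤ t := by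
    intro b b' hb hb' hne
    have := one_lt_card.2 ⟨b, hb, b', hb', hne⟩
    omega
  by_cases h1 : ∃ b ∈ T, ∃ b' ∈ T, G.Adj b b'
  · obtain ⟨b, hb, b', hb', hbb⟩ := h1
    have ht := htwo hb hb' hbb.ne
    refine (IsTriangleTiled.triangle (a := Sum.inl b) (b := Sum.inl b')
      (c := Sum.inr (⟨0, by omega⟩ : Fin t)) (by simpa) (by simp)
      (by simp)).exists_cover_of_saving T ?_ ?_
    all_goals
      have h2 : #({b, b'} : Finset V) ≤ #(T ∩ toLeft ({Sum.inl b, Sum.inl b',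
          Sum.inr (⟨0, by omega⟩ : Fin t)} : Finset (V ⊕ Fin t))) := by
        refine card_le_card fun z hz => ?_
        rcases mem_insert.1 hz with rfl | hz
        · simp [hb]
        · obtain rfl := mem_singleton.1 hz
          simp [hb']
      rw [card_pair hbb.ne] at h2
    · have h3 : #(toRight ({Sum.inl b, Sum.inl b',
          Sum.inr (⟨0, by omega⟩ : Fin t)} : Finset (V ⊕ Fin t))) ≤ 1 := by
        refine card_le_one.2 ?_
        simp
      omega
    · exact card_le_three.trans (by omega)
  have h1' : ∀ b ∈ T, ∀ w, G.Adj b w → w ∉ T := fun b hb w hbw hw => h1 ⟨b, hb, w, hw, hbw⟩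
  by_cases h2 : ∃ b ∈ T, ∃ v w, G.Adj b v ∧ G.Adj b w ∧ G.Adj v w
  · obtain ⟨b, hb, v, w, hbv, hbw, hvw⟩ := h2
    refine (IsTriangleTiled.triangle (Γ := joinComplete G t) (a := Sum.inl b) (b := Sum.inl v)
      (c := Sum.inl w) (by simpa) (by simpa) (by simpa)).exists_cover_of_saving T ?_ ?_
    all_goals
      have h2 : 0 < #(T ∩ toLeft ({Sum.inl b, Sum.inl v, Sum.inl w} : Finset (V ⊕ Fin t))) :=
        card_pos.2 ⟨b, by simp [hb]⟩
    · have h3 : #(toRight ({Sum.inl b, Sum.inl v, Sum.inl w} : Finset (V ⊕ Fin t))) = 0 := by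
        rw [card_eq_zero]
        ext; simp
      omega
    · exact card_le_three.trans (by omega)
  by_cases h3 : ∃ b ∈ T, ∃ b' ∈ T, ∃ w w', b ≠ b' ∧ w ≠ w' ∧ G.Adj b w ∧ G.Adj b' w'
  · obtain ⟨b, hb, b', hb', w, w', hbb, hww, hbw, hbw'⟩ := h3
    have ht := htwo hb hb' hbb
    have hwT := h1' b hb w hbw
    have hwT' := h1' b' hb' w' hbw'
    have hne : ∀ {u v}, u ∈ T → v ∉ T → u ≠ v := fun hu hv hh => hv (hh ▸ hu)
    refine ((IsTriangleTiled.triangle (a := Sum.inl b') (b := Sum.inl w')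
      (c := Sum.inr (⟨0, by omega⟩ : Fin t)) (by simpa) (by simp) (by simp)).insert_triangle
      (a := Sum.inl b) (b := Sum.inl w) (c := Sum.inr (⟨1, by omega⟩ : Fin t))
      (by simpa) (by simp) (by simp) (by simp [hbb, hne hb hwT'])
      (by simp [(hne hb' hwT).symm, hww]) (by simp)).exists_cover_of_saving T ?_ ?_
    all_goals
      have h2 : #({b, b'} : Finset V) ≤ #(T ∩ toLeft (insert (Sum.inl b) (insert (Sum.inl w)
          (insert (Sum.inr (⟨1, by omega⟩ : Fin t)) ({Sum.inl b', Sum.inl w',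
          Sum.inr (⟨0, by omega⟩ : Fin t)} : Finset (V ⊕ Fin t)))))) := by
        refine card_le_card fun z hz => ?_
        rcases mem_insert.1 hz with rfl | hz
        · simp [hb]
        · obtain rfl := mem_singleton.1 hz
          simp [hb']
      rw [card_pair hbb] at h2
    · have h3 : #(toRight (insert (Sum.inl b) (insert (Sum.inl w)
          (insert (Sum.inr (⟨1, by omega⟩ : Fin t)) ({Sum.inl b', Sum.inl w',
          Sum.inr (⟨0, by omega⟩ : Fin t)} : Finset (V ⊕ Fin t)))))) ≤ 2 := by
        refine (card_le_card (t := {⟨1, by omega⟩, ⟨0, by omega⟩}) fun z hz => ?_).trans card_le_two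
        simpa using hz
      omega
    · exact card_le_six.trans (by omega)
  -- Without these configurations the edges meeting T form a star. An edge avoiding w excludes a
  -- centre outside T, so the centre is b, and the star count contradicts `h`.
  exfalso
  obtain ⟨b, hb, w, hbw, -, -⟩ := exists_adj_avoiding (G := G) (Q := ∅) (T := T) (D := 0)
    (by simp) (by simp) (by simp; omega)
  have hwT := h1' b hb w hbw
  obtain ⟨b', hb', w', hbw', -, hw'⟩ := exists_adj_avoiding (G := G) (Q := {w}) (T := T)
    (D := #T) (by simp [hwT]) (by simp) (by simpa using h)
  have hww : w ≠ w' := by simpa [eq_comm] using hw'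
  have hbb : b = b' := by
    by_contra hne
    exact h3 ⟨b, hb, b', hb', w, w', hne, hww, hbw, hbw'⟩
  subst hbb
  have hstar := card_edgeFinset_le_of_star (T := T) (b := b) (by
    intro u hu v huv
    by_contra hne
    by_cases hvw : w = v
    · exact h3 ⟨b, hb, u, hu, w', v, Ne.symm hne, hvw ▸ hww.symm, hbw', huv⟩
    · exact h3 ⟨b, hb, u, hu, w, v, Ne.symm hne, hvw, hbw, huv⟩) (h1' b hb)
    (fun v w h4 h5 h6 => h2 ⟨b, hb, v, w, h4, h5, h6⟩)
  have := card_pos.2 ⟨b, hb⟩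
  omega

/-- Here s = |T| exceeds k by j + 1. Shrinking m to m' frees about (j + 1)(m + m') ≥ 1.8(j + 1)n
ordered pairs. Comparing with 2sD ≤ 2sn/7 makes j small against s, so that there are enough new
vertices; 1.8 > 12/7 gives the edges for the greedy choice. -/
theorem edge_count_arith {n k s j m m' D e : ℕ} (hn : 20 ≤ n) (hkn : 20 * k ≤ n)
    (hsn : 20 * s ≤ n) (hm : m + k = n) (hs : s = k + (j + 1)) (hm' : m = m' + (j + 1))
    (hD : 7 * D ≤ n) (hE : m * m < e + m) (h : e + m' ≤ m' * m' + 2 * (s * D)) :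
    63 * (j + 1) < 10 * s ∧ m' * m' + 4 * (3 * (j + 1) * D) < e + m' := by
  obtain ⟨p, hp⟩ : ∃ p, m + m' = p + 1 := ⟨m + m' - 1, by omega⟩
  have h1 : (j + 1) * (18 * n) ≤ (j + 1) * (10 * p) := Nat.mul_le_mul_left _ (by omega)
  have h2 : m * m + m' = m' * m' + m + (j + 1) * p := by
    have : (m + m') * (j + 1) = (p + 1) * (j + 1) := by rw [hp]
    subst hm'
    linarith
  have h3 : (j + 1) * p < 2 * (s * D) := by linarith
  have h4 : s * (7 * D) ≤ s * n := Nat.mul_le_mul_left _ hD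
  have h5 : (63 * (j + 1)) * n < (10 * s) * n := by linarith
  have h6 : (j + 1) * (7 * D) ≤ (j + 1) * n := Nat.mul_le_mul_left _ hD
  have h7 : 0 < (j + 1) * n := by positivity
  exact ⟨lt_of_mul_lt_mul_right h5 (Nat.zero_le n), by linarith⟩

/-- The vertices of low degree can be covered by disjoint triangles. -/
theorem exists_cover_of_degree_le {T : Finset V} {n k m D : ℕ} (hn : Fintype.card V = n)
    (hn20 : 20 ≤ n) (hk : k = t / 2 + 1) (hm : m + k = n) (hkn : 20 * k ≤ n)
    (hTn : 20 * #T ≤ n) (hdeg : ∀ v ∈ T, G.degree v ≤ D) (hD : 7 * D ≤ n) (hTD : #T ≤ D)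
    (hE : m * m < 2 * #G.edgeFinset + m)
    (hE' : Even t → m * m + 2 * k < 2 * #G.edgeFinset + m) :
    ∃ U, IsTriangleTiled (joinComplete G t) U ∧ (∀ b ∈ T, .inl b ∈ U) ∧ #U ≤ 3 * #T := by
  have hTc : #Tᶜ + #T = n := by rw [add_comm, card_add_card_compl, hn]
  rcases Nat.lt_or_ge t (2 * #T) with ht | ht
  swap
  · exact IsTriangleTiled.empty.exists_cover_of_saving T 
      (le_trans (by simp [show #(toRight (∅ : Finset (V ⊕ Fin t))) = 0 from rfl, ht]) le_self_add)
      (by simp)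
  rcases Nat.lt_or_ge k #T with hkT | hkT
  · obtain ⟨j, hj⟩ := Nat.exists_eq_add_of_lt hkT
    have hmT : m = #Tᶜ + (j + 1) := by omega
    -- With Q = T, an edge would have to both meet and avoid T.
    have h1 : 2 * #G.edgeFinset + #Tᶜ ≤ #Tᶜ * #Tᶜ + 2 * (#T * D) := by
      by_contra! hcon
      obtain ⟨b, hb, w, -, hb', -⟩ := exists_adj_avoiding (Q := T) (T := T) (D := D)
        (fun q _ hq => hdeg q hq) (fun _ _ _ => hTD) hcon
      exact hb' hb
    have hj1 : #T = k + (j + 1) := by omega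
    obtain ⟨h2, h3⟩ := edge_count_arith hn20 hkn hTn hm hj1 hmT hD hE h1
    refine exists_cover_of_edges (r := 2 * #T - t) hdeg hTD ?_ (by omega) (by omega)
    have h7 : (2 * #T - t - 1) * D ≤ (3 * (j + 1)) * D := Nat.mul_le_mul_right _ (by omega)
    linarith
  · have hkT' : #T = k := by omega
    have hmT : #Tᶜ = m := by omega
    rcases Nat.even_or_odd t with he | ho
    · refine exists_cover_of_card_eq ?_ ?_
      · obtain ⟨a, rfl⟩ := he
        omega
      · rw [hkT', hmT]
        exact hE' he
    · obtain ⟨a, rfl⟩ := ho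
      refine exists_cover_of_edges (r := 1) hdeg hTD ?_ (by omega) (by omega)
      rw [hmT]
      simpa using hE

end LowDegree

theorem IsTriangleTiled.three_dvd_card {W : Type*} [Fintype W] {Γ : SimpleGraph W}
    {S : Finset W} (hS : IsTriangleTiled Γ S) : 3 ∣ #S := by
  classical
  obtain ⟨P, h1, h2, h3⟩ := hS
  have hSP : S = P.toFinset.biUnion id := by
    ext v
    simp [h3]
  rw [hSP, card_biUnion fun s hs s' hs' hne => h2 (by simpa using hs) (by simpa using hs') hne]
  exact dvd_sum fun s hs => by simp [(h1 s (by simpa using hs)).card_eq]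

open Classical in
theorem card_filter_not_joinComplete_adj_inr_le {V : Type*} {G : SimpleGraph V} (t : ℕ) (x : Fin t) (S : Finset (V ⊕ Fin t)) :
    #{w ∈ S | ¬ (joinComplete G t).Adj (.inr x) w} ≤ 1 := by
  rw [← card_singleton (Sum.inr x : V ⊕ Fin t)]
  refine card_le_card fun w hw => ?_
  rcases w with w | y
  · simp at hw
  · simpa [eq_comm] using (mem_filter.1 hw).2

/-! ### The upper bound -/

section Upper

variable {V : Type*} [Fintype V] {G : SimpleGraph V} [DecidableRel G.Adj]

/-- The sum of n - deg(v) is n² - 2e(G) < (2k + 1)n, and each counted vertex contributes more than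
n/16. -/
theorem card_filter_low_degree_le {n k m : ℕ} (hn : Fintype.card V = n) (hn0 : 0 < n)
    (hm : m + k = n) (hE : m * m < 2 * #G.edgeFinset + m) :
    #{v | n < 16 * (n - G.degree v)} ≤ 32 * k + 16 := by
  set B : Finset V := {v | n < 16 * (n - G.degree v)} with hB
  have h1 : ∑ v, (n - G.degree v) + 2 * #G.edgeFinset = n * n := by
    rw [← G.sum_degrees_eq_twice_card_edges, ← sum_add_distrib,
      sum_congr rfl fun v _ => Nat.sub_add_cancel (hn ▸ (G.degree_lt_card_verts v).le)]
    simp [hn]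
  have h2 : #B * n ≤ ∑ v ∈ B, 16 * (n - G.degree v) := by
    rw [← smul_eq_mul]
    exact card_nsmul_le_sum _ _ _ fun v hv => (by simpa [hB] using hv : n < _).le
  have h3 : ∑ v ∈ B, 16 * (n - G.degree v) ≤ ∑ v, 16 * (n - G.degree v) :=
    sum_le_sum_of_subset (subset_univ B)
  rw [← mul_sum, ← mul_sum] at h3
  rw [← mul_sum] at h2
  have h4 : n * n + k * k = m * m + 2 * (k * n) := by subst hm; ring
  have h5 : #B * n ≤ (32 * k + 16) * n := by linarith [Nat.zero_le (k * k)]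
  exact Nat.le_of_mul_le_mul_right h5 hn0

variable [DecidableEq V]

/-- A vertex of not too small degree has an edge in its neighbourhood avoiding a small set. -/
theorem exists_adj_in_neighborhood {n : ℕ} (hn : Fintype.card V = n) {u : V} {B F : Finset V}
    (hB : ∀ v, v ∉ B → 16 * (n - G.degree v) ≤ n) (h1 : #F + #B < G.degree u)
    (h2 : n + 16 * #F < 16 * G.degree u) :
    ∃ v ∉ F, ∃ w ∉ F, G.Adj u v ∧ G.Adj u w ∧ G.Adj v w := by
  obtain ⟨v, hv, hvF⟩ : ∃ v ∈ G.neighborFinset u, v ∉ F ∪ B := by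
    refine exists_mem_notMem_of_card_lt_card ?_
    rw [G.card_neighborFinset_eq_degree]
    exact (card_union_le _ _).trans_lt h1
  rw [mem_union, not_or] at hvF
  rw [G.mem_neighborFinset] at hv
  have h3 := hB v hvF.2
  obtain ⟨w, hw, hw'⟩ : ∃ w ∈ G.neighborFinset u, w ∉ F ∪ (G.neighborFinset v)ᶜ := by
    refine exists_mem_notMem_of_card_lt_card ((card_union_le _ _).trans_lt ?_)
    rw [card_compl, G.card_neighborFinset_eq_degree, G.card_neighborFinset_eq_degree, hn]
    omega
  simp only [mem_union, not_or, mem_compl, not_not, G.mem_neighborFinset] at hw hw'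
  exact ⟨v, hvF.1, w, hw'.1, hv, hw, hw'.2⟩

open Classical in
theorem card_filter_not_joinComplete_adj_inl_le (t : ℕ) (u : V) (S : Finset (V ⊕ Fin t)) :
    #{w ∈ S | ¬ (joinComplete G t).Adj (.inl u) w} ≤ Fintype.card V - G.degree u := by
  rw [← G.card_neighborFinset_eq_degree, ← card_compl,
    ← card_map (Function.Embedding.inl : V ↪ V ⊕ Fin t)]
  refine card_le_card fun w hw => ?_
  rcases w with w | x
  · simpa using (mem_filter.1 hw).2
  · simp at hw

theorem hasCliqueFactor_of_card_edgeFinset {n t k m : ℕ} (hn : Fintype.card V = n)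
    (hn0 : 100000 ≤ n) (h3 : 3 ∣ n + t) (ht : 1000 * t ≤ n) (hk : k = t / 2 + 1)
    (hm : m + k = n) (hE : m * m < 2 * #G.edgeFinset + m)
    (hE' : Even t → m * m + 2 * k < 2 * #G.edgeFinset + m) :
    HasCliqueFactor (joinComplete G t) 3 := by
  -- Vertices outside B are dense enough for the Hall tiling. Those in B but not T have degree at
  -- least n/7, which exceeds n/16 by more than the at most 3|B| vertices the greedy cover must
  -- avoid.
  set B : Finset V := {v | n < 16 * (n - G.degree v)} with hB
  set T : Finset V := {v | 7 * G.degree v < n} with hT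
  have hBc : #B ≤ 32 * k + 16 := card_filter_low_degree_le hn (by omega) hm hE
  have hTB : T ⊆ B := fun v hv => by
    simp only [hT, hB, mem_filter, mem_univ, true_and] at hv ⊢
    omega
  have hTc := card_le_card hTB
  obtain ⟨U, hU, hTU, hUc⟩ := exists_cover_of_degree_le (t := t) (T := T) (D := n / 7) hn
    (by omega) hk hm (by omega) (by omega)
    (fun v hv => by
      simp only [hT, mem_filter, mem_univ, true_and] at hv
      omega) (by omega) (by omega) hE hE'
  have hBT := card_sdiff_add_card_eq_card hTB
  obtain ⟨U', hU', hUU', hBU, hU'c⟩ := hU.exists_cover ((B \ T).map .inl) (M := 3 * #B)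
    (by rw [card_map]; omega) (by
      intro v hv _ F hF
      obtain ⟨u, hu, rfl⟩ := mem_map.1 hv
      have hFl : #F.toLeft ≤ #F := card_toLeft_le
      have huT : n ≤ 7 * G.degree u := by simpa [hT] using (mem_sdiff.1 hu).2
      obtain ⟨a, ha, b, hb, h1, h2, h3⟩ := exists_adj_in_neighborhood (G := G) (u := u) (B := B)
        (F := F.toLeft) hn (fun v hv => by simpa [hB] using hv) (by omega) (by omega)
      exact ⟨.inl a, by simpa using ha, .inl b, by simpa using hb, by simpa, by simpa, by simpa⟩)
  rw [card_map] at hU'c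
  have hcompl : #U'ᶜ + #U' = n + t := by
    rw [add_comm, card_add_card_compl, Fintype.card_sum, hn, Fintype.card_fin]
  have hdvd := hU'.three_dvd_card
  obtain ⟨q, hq⟩ : 3 ∣ #U'ᶜ := (Nat.dvd_add_left hdvd).1 (hcompl ▸ h3)
  have hrest : IsTriangleTiled (joinComplete G t) U'ᶜ := by
    refine IsTriangleTiled.of_card_not_adj_le (d := n / 16 + 1) hq ?_ (by omega)
    rintro (u | x) hv
    · refine (card_filter_not_joinComplete_adj_inl_le t u _).trans ?_
      have huB : u ∉ B := by
        intro huB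
        rw [mem_compl] at hv
        by_cases huT : u ∈ T
        · exact hv (hUU' (hTU u huT))
        · exact hv (hBU (by simp [huB, huT]))
      have : 16 * (n - G.degree u) ≤ n := by simpa [hB] using huB
      rw [hn]
      omega
    · exact (card_filter_not_joinComplete_adj_inr_le t x _).trans (by omega)
  refine IsTriangleTiled.hasCliqueFactor ?_
  rw [← union_compl U']
  exact hU'.union hrest disjoint_compl_right

end Upper

/-! ### The extremal graphs -/

section Sharp

variable {V : Type*}

/-- The graph in which the vertices of `S` are pairwise non-adjacent and joined exactly to the
vertices of `C`, and all other pairs are edges. -/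
def extremalGraph (S C : Finset V) : SimpleGraph V where
  Adj u v := u ≠ v ∧ (u ∉ S ∧ v ∉ S ∨ u ∈ C ∨ v ∈ C)
  symm := ⟨fun u v h => ⟨h.1.symm, by tauto⟩⟩
  loopless := ⟨fun u h => h.1 rfl⟩

/-- The triangles at distinct vertices of S are disjoint, and each uses two further vertices from C
and the t new ones. -/
theorem not_hasCliqueFactor_extremalGraph {S C : Finset V} {t : ℕ} (hSC : Disjoint S C)
    (h : #C + t < 2 * #S) : ¬ HasCliqueFactor (joinComplete (extremalGraph S C) t) 3 := by
  classical
  rintro ⟨P, hP1, hP2, hP3⟩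
  choose p hpP hp using hP3
  have hdisj : ∀ v w, p v ≠ p w → Disjoint (p v) (p w) := fun v w hne => hP2 (hpP v) (hpP w) hne
  let Y : Finset (V ⊕ Fin t) := C.disjSum univ
  have hmem : ∀ v ∈ S, ∀ w, (joinComplete (extremalGraph S C) t).Adj (.inl v) w → w ∈ Y := by
    rintro v hv (w | x) hvw
    · have hvC : v ∉ C := Finset.disjoint_left.1 hSC hv
      have := (joinComplete_adj_inl_inl.1 hvw).2
      simp only [hv, not_true_eq_false, false_and, hvC, false_or] at this
      simpa [Y] using this
    · simp [Y]
  have hSY : ∀ v ∈ S, Sum.inl v ∉ Y := fun v hv => by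
    simpa [Y] using Finset.disjoint_left.1 hSC hv
  have herase : ∀ v ∈ S, (p (.inl v)).erase (.inl v) ⊆ Y := by
    intro v hv w hw
    rw [mem_erase] at hw
    exact hmem v hv w ((hP1 _ (hpP (.inl v))).isClique (hp (.inl v)) hw.2 hw.1.symm)
  have hpd : (S : Set V).PairwiseDisjoint fun v => (p (.inl v)).erase (.inl v) := by
    intro v hv w hw hne
    refine (hdisj (.inl v) (.inl w) fun heq => ?_).mono (erase_subset _ _) (erase_subset _ _)
    refine hSY v hv (herase w hw ?_)
    rw [mem_erase, ← heq]
    exact ⟨by simpa using hne, hp _⟩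
  have hle := card_le_card (biUnion_subset.2 herase)
  rw [card_biUnion hpd, sum_congr rfl fun v _ => by
    rw [card_erase_of_mem (hp (.inl v)), (hP1 _ (hpP (.inl v))).card_eq], sum_const,
    card_disjSum, card_univ, Fintype.card_fin, smul_eq_mul] at hle
  omega

theorem extremalGraph_adj {S C : Finset V} {u v : V} :
    (extremalGraph S C).Adj u v ↔ u ≠ v ∧ (u ∉ S ∧ v ∉ S ∨ u ∈ C ∨ v ∈ C) :=
  Iff.rfl

variable [Fintype V] [DecidableEq V]

theorem card_edgeFinset_extremalGraph {S C : Finset V} [DecidableRel (extremalGraph S C).Adj]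
    (hSC : Disjoint S C) :
    2 * #(extremalGraph S C).edgeFinset + #Sᶜ = #Sᶜ * #Sᶜ + 2 * (#S * #C) := by
  rw [← card_filter_adj]
  have hdisj := Finset.disjoint_left.1 hSC
  have heq : ({p : V × V | (extremalGraph S C).Adj p.1 p.2} : Finset (V × V)) =
      Sᶜ.offDiag ∪ (S ×ˢ C ∪ C ×ˢ S) := by
    ext ⟨u, v⟩
    simp only [extremalGraph_adj, mem_filter, mem_univ, true_and, mem_union, mem_offDiag, mem_compl,
      mem_product]
    have hu := @hdisj u
    have hv := @hdisj v
    by_cases huv : u = v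
    · subst huv
      tauto
    · tauto
  have hd1 : Disjoint (S ×ˢ C) (C ×ˢ S) := by
    rw [Finset.disjoint_left]
    rintro ⟨u, v⟩ h1 h2
    simp only [mem_product] at h1 h2
    exact hdisj h1.1 h2.1
  have hd2 : Disjoint Sᶜ.offDiag (S ×ˢ C ∪ C ×ˢ S) := by
    rw [Finset.disjoint_left]
    rintro ⟨u, v⟩ h1 h2
    simp only [mem_union, mem_product, mem_offDiag, mem_compl] at h1 h2
    tauto
  rw [heq, card_union_of_disjoint hd2, card_union_of_disjoint hd1, offDiag_card, card_product,
    card_product, mul_comm #C]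
  have := Nat.le_mul_self #Sᶜ
  omega

end Sharp

theorem halfCeil_eq (t : ℕ) : halfCeil t = t / 2 + 1 := by
  rw [halfCeil, Nat.ceil_eq_iff (by omega)]
  rcases Nat.even_or_odd' t with ⟨a, rfl | rfl⟩
  · rw [Nat.mul_div_cancel_left a two_pos]
    push_cast
    constructor <;> linarith
  · rw [show (2 * a + 1) / 2 = a by omega]
    push_cast
    constructor <;> linarith

/-- Removing k vertices from a complete graph leaves C(m,2) edges; doubling avoids division. -/
theorem two_mul_edgeBound {n t k m : ℕ} (hk : k = t / 2 + 1) (hm : m + k = n) :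
    2 * edgeBound n t = (m : ℤ) * m - m + if Odd t then 0 else 2 * (k : ℤ) := by
  have hchoose : ∀ a : ℕ, 2 * (a.choose 2 : ℤ) = (a : ℤ) * a - a := by
    intro a
    have h := Nat.choose_two_right a
    have h' := Nat.div_mul_cancel (Nat.even_mul_pred_self a).two_dvd
    rw [← h] at h'
    rcases a with _ | a
    · simp
    · have : (((a + 1).choose 2 * 2 : ℕ) : ℤ) = ((a + 1) * a : ℕ) := by rw [h']; rfl
      push_cast at this ⊢
      linarith
  rw [edgeBound, halfCeil_eq, ← hk, mul_sub, mul_sub, hchoose, hchoose, ← hm]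
  split_ifs <;> push_cast <;> ring

end TriangleFactorDeficiency

theorem theorem2p2 :
    ∃ n₀ : ℕ, ∀ n t : ℕ, n₀ ≤ n → 3 ∣ n + t → (t : ℝ) ≤ (n : ℝ) / 1000 →
      (∀ G : SimpleGraph (Fin n),
        ¬ TriangleFactorDeficiency.HasCliqueFactor
            (TriangleFactorDeficiency.joinComplete G t) 3 →
          (G.edgeSet.ncard : ℤ) ≤ TriangleFactorDeficiency.edgeBound n t) ∧
      (∃ G : SimpleGraph (Fin n),
        ¬ TriangleFactorDeficiency.HasCliqueFactor
            (TriangleFactorDeficiency.joinComplete G t) 3 ∧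
          (G.edgeSet.ncard : ℤ) = TriangleFactorDeficiency.edgeBound n t) := by
  classical
  have hncard : ∀ {n : ℕ} (G : SimpleGraph (Fin n)),
      G.edgeSet.ncard = G.edgeFinset.card := fun G => by
    rw [← SimpleGraph.coe_edgeFinset, Set.ncard_coe_finset]
  refine ⟨100000, fun n t hn h3 ht => ?_⟩
  have ht' : 1000 * t ≤ n := by
    have : (1000 : ℝ) * t ≤ n := by linarith
    exact_mod_cast this
  obtain ⟨k, hk⟩ : ∃ k, k = t / 2 + 1 := ⟨_, rfl⟩
  obtain ⟨m, hm⟩ : ∃ m, m + k = n := ⟨n - k, by omega⟩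
  have hbound := TriangleFactorDeficiency.two_mul_edgeBound hk hm
  refine ⟨fun G hG => ?_, ?_⟩
  · rw [hncard]
    by_contra! hlt
    refine hG (TriangleFactorDeficiency.hasCliqueFactor_of_card_edgeFinset (m := m) (by simp) hn
      h3 ht' hk hm ?_ fun he => ?_)
    · zify
      split_ifs at hbound <;> linarith
    · zify
      rw [if_neg (Nat.not_odd_iff_even.2 he)] at hbound
      linarith
  -- c is the size of C, chosen so that c + t = 2k - 1 in either parity.
  · obtain ⟨c, hc, hc'⟩ : ∃ c, c + t < 2 * k ∧
        2 * TriangleFactorDeficiency.edgeBound n t = (m : ℤ) * m - m + 2 * (k * c) := by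
      rcases Nat.even_or_odd t with he | ho
      · refine ⟨1, ?_, by rw [hbound, if_neg (Nat.not_odd_iff_even.2 he)]; simp⟩
        obtain ⟨a, rfl⟩ := he
        omega
      · refine ⟨0, ?_, by rw [hbound, if_pos ho]; simp⟩
        obtain ⟨a, rfl⟩ := ho
        omega
    obtain ⟨S, hS⟩ := Finset.exists_subset_card_eq
      (s := (Finset.univ : Finset (Fin n))) (n := k) (by simp; omega)
    have hSc : Sᶜ.card = m := by
      rw [Finset.card_compl, hS.2, Fintype.card_fin]
      omega
    obtain ⟨C, hCS, hC⟩ := Finset.exists_subset_card_eq (s := Sᶜ) (n := c) (by omega)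
    have hSC : Disjoint S C := Finset.disjoint_left.2 fun v hv hv' =>
      (Finset.mem_compl.1 (hCS hv')) hv
    refine ⟨TriangleFactorDeficiency.extremalGraph S C,
      TriangleFactorDeficiency.not_hasCliqueFactor_extremalGraph hSC (by rw [hC, hS.2]; exact hc),
      ?_⟩
    have h := TriangleFactorDeficiency.card_edgeFinset_extremalGraph hSC
    rw [hSc, hS.2, hC] at h
    zify at h
    rw [hncard]
    linarith
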